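/- For $x=(x^1,x^2)\in\mathbb R^2$ write $x^\perp=(-x^2,x^1)$. Let $\gamma_1,\dots,\gamma_N$ and $\gamma_1^c,\dots,\gamma_N^c$ be nonzero real numbers. Let $\boldsymbol{x}_0=(x_{0,1},\dots,x_{0,N})$ and $\boldsymbol{x}_f=(x_{f,1},\dots,x_{f,N})$ in $(\mathbb R^2)^N$ satisfy $x_{0,i}\neq x_{0,j}$ and $x_{f,i}\neq x_{f,j}$ for $i\neq j$, and let $T>0$. Then there exist $N$ control trajectories $y_1,\dots,y_N\in C^\infty([0,T];\mathbb R^2)$ such that the system $$\frac{dx_i}{dt}(t)=\sum_{j\neq i}\gamma_j\frac{(x_i(t)-x_j(t))^\perp}{|x_i(t)-x_j(t)|^2}+\sum_{j=1}^N\gamma_j^c\frac{(x_i(t)-y_j(t))^\perp}{|x_i(t)-y_j(t)|^2},\qquad x_i(0)=x_{0,i},\qquad i=1,\dots,N,$$ has a solution $\boldsymbol{x}=(x_1,\dots,x_N)$ well defined on all of $[0,T]$, unique (in the sense that every solution on an interval $[0,\tau]$ with $0\le\tau\le T$ coincides with $\boldsymbol{x}$ there), and $\boldsymbol{x}(T)=\boldsymbol{x}_f$.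 Here a solution is understood to exist only as long as $x_i\neq x_j$ for $i\neq j$ and $x_i\neq y_j$ for all $i,j$. Moreover the $2N$ points never meet: for all $t\in[0,T]$ one has $x_i(t)\neq y_j(t)$ for all $i,j$, and $x_i(t)\neq x_j(t)$ and $y_i(t)\neq y_j(t)$ for all $i\neq j$. -/

import Mathlib

open scoped ContDiff

noncomputable section

/-- The Euclidean plane `ℝ²`. -/
abbrev Plane : Type := EuclideanSpace ℝ (Fin 2)

/-- Rotation by the angle `π / 2`: `(x¹, x²)^⊥ = (-x², x¹)`. -/
def perp (x : Plane) : Plane := !₂[-x 1, x 0]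

/-- The Biot–Savart kernel `K(x) = x^⊥ / |x|²`; it is only used for `x ≠ 0`. -/
def biotSavart (x : Plane) : Plane := (‖x‖ ^ 2)⁻¹ • perp x

/-- The velocity of the `i`-th of `N` vortices at `x` with intensities `γ`, in the presence of
`N` control vortices at `y` with intensities `γc`. -/
def vortexVelocity {N : ℕ} (γ γc : Fin N → ℝ) (x y : Fin N → Plane) (i : Fin N) : Plane :=
  (∑ j ∈ Finset.univ.erase i, γ j • biotSavart (x i - x j))
    + ∑ j, γc j • biotSavart (x i - y j)

/-- `x` is a (classical) solution on `[0, T]` of the vortex system with control `y` and initial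
positions `x₀`. A solution exists only as long as the right-hand side makes sense: the vortices
meet neither each other nor the control vortices. -/
structure IsVortexSolution {N : ℕ} (γ γc : Fin N → ℝ) (T : ℝ) (x₀ : Fin N → Plane)
    (y x : ℝ → Fin N → Plane) : Prop where
  initial : x 0 = x₀
  vortex_ne : ∀ t ∈ Set.Icc 0 T, ∀ i j, i ≠ j → x t i ≠ x t j
  control_ne : ∀ t ∈ Set.Icc 0 T, ∀ i j, x t i ≠ y t j
  ode : ∀ t ∈ Set.Icc 0 T, ∀ i,
    HasDerivWithinAt (fun s => x s i) (vortexVelocity γ γc (x t) (y t) i) (Set.Icc 0 T) t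

end

open Set Filter Topology

/-! The trajectories are prescribed first and the controls are then solved for. In complex notation
the control condition at each time is `∑ j, c j / (z i - ζ j) = W i`, where `W` is what the controls
must supply once the mutual interaction is subtracted. When every `W i` is large, this system has a
solution with `ζ j` close to `z j`, found as the fixed point of a contraction and smooth in time
(`exists_contDiffOn_sum_div_eq`). A collision-free path joins the endpoints
(`exists_contDiff_path_pairwise_ne`). Adding one fast closed loop to all vortices keeps their
differences and endpoints but makes `W` as large as needed. Uniqueness is Grönwall's inequality on
configurations with separation bounded below (`IsVortexSolution.eqOn`). -/

/-! ### Solving for the controls -/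

/-- A family of uniform contractions of a closed ball, depending smoothly on a real parameter, has
fixed points that depend smoothly on the parameter. -/
theorem exists_contDiffOn_fixedPoint {E : Type*} [NormedAddCommGroup E] [NormedSpace ℝ E]
    [CompleteSpace E] {s : Set ℝ} {G : ℝ × E → E} {r : ℝ} {K : NNReal} (hK : K < 1) (hr : 0 < r)
    (hmaps : ∀ t ∈ s, ∀ a ∈ Metric.closedBall (0 : E) r, G (t, a) ∈ Metric.ball (0 : E) r)
    (hlip : ∀ t ∈ s, LipschitzOnWith K (fun a => G (t, a)) (Metric.closedBall 0 r))
    (hsmooth : ∀ t ∈ s, ∀ a ∈ Metric.ball (0 : E) r, ContDiffAt ℝ ∞ G (t, a)) :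
    ∃ α : ℝ → E, ContDiffOn ℝ ∞ α s ∧
      ∀ t ∈ s, α t ∈ Metric.ball (0 : E) r ∧ G (t, α t) = α t := by
  have hfix : ∀ t, ∃ a, t ∈ s → a ∈ Metric.ball (0 : E) r ∧ G (t, a) = a := by
    intro t
    by_cases ht : t ∈ s
    · have hm : MapsTo (fun a => G (t, a)) (Metric.closedBall 0 r) (Metric.closedBall 0 r) :=
        fun a ha => Metric.ball_subset_closedBall (hmaps t ht a ha)
      obtain ⟨a, ha, hfa, -⟩ := ContractingWith.exists_fixedPoint'
        Metric.isClosed_closedBall.isComplete hm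
        ⟨hK, (hlip t ht).mapsToRestrict hm⟩ (Metric.mem_closedBall_self hr.le)
        (edist_ne_top _ _)
      have hfa' : G (t, a) = a := hfa
      exact ⟨a, fun _ => ⟨hfa' ▸ hmaps t ht a ha, hfa'⟩⟩
    · exact ⟨0, fun h => absurd h ht⟩
  choose α hα using hfix
  refine ⟨α, fun t₀ ht₀ => ?_, hα⟩
  obtain ⟨hball, hG⟩ := hα t₀ ht₀
  -- Implicit function theorem for `a - G (t, a)`: the partial derivative in `a` is `1` minus an
  -- operator of norm at most `K < 1`, hence invertible.
  set f : ℝ × E → E := fun p => p.2 - G p with hf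
  have hGs := hsmooth t₀ ht₀ _ hball
  have cdf : ContDiffAt ℝ ∞ f (t₀, α t₀) := contDiffAt_snd.sub hGs
  have hGd : HasFDerivAt G (fderiv ℝ G (t₀, α t₀)) (t₀, α t₀) :=
    (hGs.differentiableAt (by simp)).hasFDerivAt
  have hpart : HasFDerivAt (fun a => G (t₀, a))
      (fderiv ℝ G (t₀, α t₀) ∘L .inr ℝ ℝ E) (α t₀) :=
    hGd.comp (α t₀) (hasFDerivAt_prodMk_right t₀ (α t₀))
  have hnorm : ‖fderiv ℝ G (t₀, α t₀) ∘L .inr ℝ ℝ E‖ < 1 :=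
    lt_of_le_of_lt (hpart.le_of_lipschitzOn
      (mem_of_superset (Metric.isOpen_ball.mem_nhds hball) Metric.ball_subset_closedBall)
      (hlip t₀ ht₀)) (by exact_mod_cast hK)
  have hderiv : fderiv ℝ f (t₀, α t₀) ∘L .inr ℝ ℝ E
      = 1 - fderiv ℝ G (t₀, α t₀) ∘L .inr ℝ ℝ E := by
    have : fderiv ℝ f (t₀, α t₀) = .snd ℝ ℝ E - fderiv ℝ G (t₀, α t₀) :=
      (hasFDerivAt_snd.sub hGd).fderiv
    rw [this]
    ext a
    simp
  have hinv : (fderiv ℝ f (t₀, α t₀) ∘L .inr ℝ ℝ E).IsInvertible := by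
    rw [hderiv]
    obtain ⟨u, hu⟩ := isUnit_one_sub_of_norm_lt_one hnorm
    exact ⟨ContinuousLinearEquiv.unitsEquiv ℝ E u, hu⟩
  have hψ := cdf.contDiffAt_implicitFunction (by simp) hinv
  have hψ₀ := cdf.implicitFunction_apply_self (by simp) hinv
  have hψe := cdf.eventually_apply_implicitFunction (by simp) hinv
  set ψ := cdf.implicitFunction (by simp) hinv
  have hψb : ∀ᶠ t in 𝓝 t₀, ψ t ∈ Metric.ball (0 : E) r :=
    hψ.continuousAt.eventually_mem
      (Metric.isOpen_ball.mem_nhds (by rw [hψ₀]; exact hball))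
  refine hψ.contDiffWithinAt.congr_of_eventuallyEq ?_ hψ₀.symm
  filter_upwards [mem_nhdsWithin_of_mem_nhds (hψe.and hψb), self_mem_nhdsWithin] with t ht hts
  obtain ⟨h1, h2⟩ := ht
  have h3 : G (t, ψ t) = ψ t := by
    have : ψ t - G (t, ψ t) = 0 := by
      rw [← sub_eq_zero.2 hG.symm]; exact h1
    exact (sub_eq_zero.1 this).symm
  obtain ⟨h4, h5⟩ := hα t hts
  -- Uniqueness of the fixed point identifies the local smooth branch `ψ` with `α`.
  have h6 := (hlip t hts).dist_le_mul _ (Metric.ball_subset_closedBall h4) _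
    (Metric.ball_subset_closedBall h2)
  simp only [h3, h5] at h6
  have hK' : (K : ℝ) < 1 := by exact_mod_cast hK
  have : dist (α t) (ψ t) ≤ 0 := by nlinarith [dist_nonneg (x := α t) (y := ψ t)]
  exact dist_le_zero.1 this

/-- The equations `∑ j, c j / (z i - ζ j) = W i` can be solved for `ζ`, smoothly in a parameter,
when the `W i` are large. -/
theorem exists_contDiffOn_sum_div_eq {ι : Type*} [Fintype ι] [DecidableEq ι] {c : ι → ℝ}
    (hc : ∀ i, c i ≠ 0) {s : Set ℝ} {z W : ℝ → ι → ℂ} {δ r : ℝ} (hδ : 0 < δ) (hr : 0 < r)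
    (hcr : (∑ j, |c j|) * r ≤ δ / 4)
    (hz : ∀ i, ∀ t ∈ s, ContDiffAt ℝ ∞ (fun t => z t i) t)
    (hWs : ∀ i, ∀ t ∈ s, ContDiffAt ℝ ∞ (fun t => W t i) t)
    (hsep : ∀ t ∈ s, ∀ i j, i ≠ j → δ ≤ ‖z t i - z t j‖)
    (hW : ∀ t ∈ s, ∀ i, 3 / r ≤ ‖W t i‖) :
    ∃ ζ : ℝ → ι → ℂ, (∀ j, ContDiffOn ℝ ∞ (fun t => ζ t j) s) ∧
      ∀ t ∈ s, (∀ i j, z t i ≠ ζ t j) ∧ (∀ i j, i ≠ j → ζ t i ≠ ζ t j) ∧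
        ∀ i, ∑ j, (c j : ℂ) / (z t i - ζ t j) = W t i := by
  -- Substituting `ζ j = z j - c j * a j` turns the diagonal term into `1 / a i`, so the system
  -- reads `1 / a i + S i = W i`, that is, `a = G (t, a)`.
  set S : ι → ℝ × (ι → ℂ) → ℂ := fun i p =>
    ∑ j ∈ Finset.univ.erase i, (c j : ℂ) / (z p.1 i - z p.1 j + c j * p.2 j) with hS
  set G : ℝ × (ι → ℂ) → ι → ℂ := fun p i => (W p.1 i - S i p)⁻¹ with hG
  have hcj : ∀ j, |c j| * r ≤ δ / 4 := fun j => le_trans (mul_le_mul_of_nonneg_right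
    (Finset.single_le_sum (f := fun j => |c j|) (fun _ _ => abs_nonneg _) (Finset.mem_univ j))
    hr.le) hcr
  have hca : ∀ a ∈ Metric.closedBall (0 : ι → ℂ) r, ∀ j, ‖(c j : ℂ) * a j‖ ≤ δ / 4 := by
    intro a ha j
    rw [norm_mul, Complex.norm_real, Real.norm_eq_abs]
    refine le_trans (mul_le_mul_of_nonneg_left ?_ (abs_nonneg _)) (hcj j)
    exact (norm_le_pi_norm a j).trans (by simpa using ha)
  have hden : ∀ t ∈ s, ∀ a ∈ Metric.closedBall (0 : ι → ℂ) r, ∀ i j, j ≠ i →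
      3 / 4 * δ ≤ ‖z t i - z t j + c j * a j‖ := by
    intro t ht a ha i j hij
    have h1 := hsep t ht i j hij.symm
    have h2 := hca a ha j
    have h3 := norm_sub_norm_le (z t i - z t j) (-(c j * a j))
    rw [norm_neg, sub_neg_eq_add] at h3
    linarith
  have hSle : ∀ t ∈ s, ∀ a ∈ Metric.closedBall (0 : ι → ℂ) r, ∀ i, ‖S i (t, a)‖ ≤ 1 / r := by
    intro t ht a ha i
    calc ‖S i (t, a)‖ ≤ ∑ j ∈ Finset.univ.erase i, |c j| / (3 / 4 * δ) := by
          refine norm_sum_le_of_le _ fun j hj => ?_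
          rw [norm_div, Complex.norm_real, Real.norm_eq_abs]
          exact div_le_div_of_nonneg_left (abs_nonneg _) (by positivity)
            (hden t ht a ha i j (Finset.ne_of_mem_erase hj))
      _ ≤ ∑ j, |c j| / (3 / 4 * δ) := Finset.sum_le_sum_of_subset_of_nonneg
          (Finset.erase_subset _ _) fun _ _ _ => by positivity
      _ = (∑ j, |c j|) / (3 / 4 * δ) := by rw [Finset.sum_div]
      _ ≤ 1 / r := by
          rw [div_le_div_iff₀ (by positivity) hr]
          linarith
  have hlow : ∀ t ∈ s, ∀ a ∈ Metric.closedBall (0 : ι → ℂ) r, ∀ i,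
      2 / r ≤ ‖W t i - S i (t, a)‖ := by
    intro t ht a ha i
    have h1 := norm_sub_norm_le (W t i) (S i (t, a))
    have h2 := hSle t ht a ha i
    have h3 := hW t ht i
    have h4 : 3 / r = 2 / r + 1 / r := by ring
    linarith
  have hne : ∀ t ∈ s, ∀ a ∈ Metric.closedBall (0 : ι → ℂ) r, ∀ i, W t i - S i (t, a) ≠ 0 :=
    fun t ht a ha i => norm_pos_iff.1 (lt_of_lt_of_le (by positivity) (hlow t ht a ha i))
  have hdne : ∀ t ∈ s, ∀ a ∈ Metric.closedBall (0 : ι → ℂ) r, ∀ i j, j ≠ i →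
      z t i - z t j + c j * a j ≠ 0 := fun t ht a ha i j hij =>
    norm_pos_iff.1 (lt_of_lt_of_le (by positivity) (hden t ht a ha i j hij))
  have hSlip : ∀ t ∈ s, ∀ a ∈ Metric.closedBall (0 : ι → ℂ) r,
      ∀ b ∈ Metric.closedBall (0 : ι → ℂ) r, ∀ i,
      ‖S i (t, a) - S i (t, b)‖ ≤ (1 / r) ^ 2 * ‖a - b‖ := by
    intro t ht a ha b hb i
    have key : ∀ j ∈ Finset.univ.erase i,
        ‖(c j : ℂ) / (z t i - z t j + c j * a j) - (c j : ℂ) / (z t i - z t j + c j * b j)‖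
          ≤ |c j| * ((δ / 4 / r) / (3 / 4 * δ) ^ 2 * ‖a - b‖) := by
      intro j hj
      have hij := Finset.ne_of_mem_erase hj
      have h1 := hdne t ht a ha i j hij
      have h2 := hdne t ht b hb i j hij
      have h3 : (c j : ℂ) / (z t i - z t j + c j * a j) - (c j : ℂ) / (z t i - z t j + c j * b j)
          = c j * (c j * (b j - a j)) /
            ((z t i - z t j + c j * a j) * (z t i - z t j + c j * b j)) := by
        field_simp
        ring
      rw [h3, norm_div, norm_mul, norm_mul, norm_mul, Complex.norm_real, Real.norm_eq_abs]
      have h4 : ‖b j - a j‖ ≤ ‖a - b‖ := by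
        rw [norm_sub_rev]; exact norm_le_pi_norm (a - b) j
      have h5 : |c j| ≤ δ / 4 / r := by rw [le_div_iff₀ hr]; exact hcj j
      have h6 := hden t ht a ha i j hij
      have h7 := hden t ht b hb i j hij
      calc |c j| * (|c j| * ‖b j - a j‖) /
            (‖z t i - z t j + c j * a j‖ * ‖z t i - z t j + c j * b j‖)
          ≤ |c j| * (δ / 4 / r * ‖a - b‖) / ((3 / 4 * δ) * (3 / 4 * δ)) := by gcongr
        _ = _ := by ring
    calc ‖S i (t, a) - S i (t, b)‖
        ≤ ∑ j ∈ Finset.univ.erase i, |c j| * ((δ / 4 / r) / (3 / 4 * δ) ^ 2 * ‖a - b‖) := by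
          rw [hS, ← Finset.sum_sub_distrib]
          exact norm_sum_le_of_le _ key
      _ ≤ ∑ j, |c j| * ((δ / 4 / r) / (3 / 4 * δ) ^ 2 * ‖a - b‖) :=
          Finset.sum_le_sum_of_subset_of_nonneg (Finset.erase_subset _ _)
            fun _ _ _ => by positivity
      _ = (∑ j, |c j|) * ((δ / 4 / r) / (3 / 4 * δ) ^ 2 * ‖a - b‖) := by rw [Finset.sum_mul]
      _ ≤ (δ / 4 / r) * ((δ / 4 / r) / (3 / 4 * δ) ^ 2 * ‖a - b‖) := by
          gcongr
          rw [le_div_iff₀ hr]; exact hcr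
      _ = 1 / 9 * ((1 / r) ^ 2 * ‖a - b‖) := by field_simp; ring
      _ ≤ (1 / r) ^ 2 * ‖a - b‖ := by
          have : 0 ≤ (1 / r) ^ 2 * ‖a - b‖ := by positivity
          linarith
  -- `K = 1 / 4` is the Lipschitz constant `(1 / r) ^ 2` of `S` divided by the square of the lower
  -- bound `2 / r` on `W - S`.
  obtain ⟨α, hα, hfix⟩ := exists_contDiffOn_fixedPoint (s := s) (G := G) (r := r) (K := 1 / 4)
    (by rw [← NNReal.coe_lt_coe]; norm_num) hr
    (by
      intro t ht a ha
      rw [mem_ball_zero_iff, pi_norm_lt_iff hr]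
      intro i
      have h := hlow t ht a ha i
      calc ‖G (t, a) i‖ = ‖W t i - S i (t, a)‖⁻¹ := by rw [hG]; exact norm_inv _
        _ ≤ (2 / r)⁻¹ := inv_anti₀ (by positivity) h
        _ < r := by rw [inv_div]; linarith)
    (by
      intro t ht
      refine LipschitzOnWith.of_dist_le_mul fun a ha b hb => ?_
      rw [dist_eq_norm, dist_eq_norm, pi_norm_le_iff_of_nonneg (by positivity)]
      intro i
      have h1 := hne t ht a ha i
      have h2 := hne t ht b hb i
      have h3 : (G (t, a) - G (t, b)) i = (S i (t, a) - S i (t, b)) /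
          ((W t i - S i (t, a)) * (W t i - S i (t, b))) := by
        simp only [hG, Pi.sub_apply]
        field_simp
        ring
      rw [h3, norm_div, norm_mul]
      calc _ ≤ (1 / r) ^ 2 * ‖a - b‖ / ((2 / r) * (2 / r)) := by
            gcongr
            · exact hSlip t ht a ha b hb i
            · exact hlow t ht a ha i
            · exact hlow t ht b hb i
        _ = 1 / 4 * ‖a - b‖ := by field_simp; norm_num
        _ = _ := by norm_num)
    (by
      intro t ht a ha
      have ha' := Metric.ball_subset_closedBall ha
      rw [contDiffAt_pi]
      intro i
      have hcomp : ∀ f : ℝ → ℂ, ContDiffAt ℝ ∞ f t →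
          ContDiffAt ℝ ∞ (fun p : ℝ × (ι → ℂ) => f p.1) (t, a) :=
        fun f hf => ContDiffAt.comp (t, a) (f := Prod.fst) (g := f) hf contDiffAt_fst
      refine ContDiffAt.inv (ContDiffAt.sub (hcomp _ (hWs i t ht)) ?_) (hne t ht a ha' i)
      simp only [hS, div_eq_mul_inv]
      refine ContDiffAt.sum fun j hj => contDiffAt_const.mul (ContDiffAt.inv ?_
        (hdne t ht a ha' i j (Finset.ne_of_mem_erase hj)))
      refine ((hcomp _ (hz i t ht)).sub (hcomp _ (hz j t ht))).add (contDiffAt_const.mul ?_)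
      fun_prop)
  refine ⟨fun t j => z t j - c j * α t j, fun j => ?_, fun t ht => ?_⟩
  · refine ContDiffOn.sub (fun t ht => (hz j t ht).contDiffWithinAt) (contDiffOn_const.mul ?_)
    exact contDiffOn_pi.1 hα j
  obtain ⟨hb, hf⟩ := hfix t ht
  have hb' := Metric.ball_subset_closedBall hb
  have hαi : ∀ i, α t i = (W t i - S i (t, α t))⁻¹ := fun i => (congrFun hf i).symm
  have hα0 : ∀ i, α t i ≠ 0 := fun i => by rw [hαi]; exact inv_ne_zero (hne t ht _ hb' i)
  have hci : ∀ i, (c i : ℂ) ≠ 0 := fun i => by exact_mod_cast hc i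
  refine ⟨fun i j h => ?_, fun i j hij h => ?_, fun i => ?_⟩
  · have h' : z t i - z t j + c j * α t j = 0 := by rw [h]; ring
    by_cases hij : j = i
    · subst hij
      exact mul_ne_zero (hci j) (hα0 j) (by simpa using h')
    · exact hdne t ht _ hb' i j hij h'
  -- Coinciding controls would give a quantity of norm at least `3 / 4 * δ` and at most `δ / 4`.
  · have h1 := hden t ht _ hb' i j hij.symm
    have h2 : z t i - z t j + c j * α t j = c i * α t i := by
      linear_combination h
    rw [h2] at h1
    linarith [hca _ hb' i]
  · have h1 : ∀ j, (c j : ℂ) / (z t i - (z t j - c j * α t j))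
        = (c j : ℂ) / (z t i - z t j + c j * α t j) := fun j => by ring
    simp only [h1]
    rw [← Finset.add_sum_erase _ _ (Finset.mem_univ i)]
    have h2 : (c i : ℂ) / (z t i - z t i + c i * α t i) = W t i - S i (t, α t) := by
      rw [sub_self, zero_add, div_mul_eq_div_div, div_self (hci i), one_div, hαi i, inv_inv]
    rw [h2]
    exact sub_add_cancel _ _

/-! ### Collision-free paths and uniform separation -/

/-- Two configurations of distinct points in `ℂ` are joined by a smooth path of such
configurations. -/
theorem exists_contDiff_path_pairwise_ne {ι : Type*} [Finite ι] {a b : ι → ℂ}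
    (ha : ∀ i j, i ≠ j → a i ≠ a j) (hb : ∀ i j, i ≠ j → b i ≠ b j) {T : ℝ} (hT : 0 < T) :
    ∃ p : ℝ → ι → ℂ, (∀ i, ContDiff ℝ ∞ fun t => p t i) ∧ p 0 = a ∧ p T = b ∧
      ∀ t ∈ Icc 0 T, ∀ i j, i ≠ j → p t i ≠ p t j := by
  -- Straight-line interpolation with its parameter bent into an arc from `0` to `1` in `ℂ`. Arcs
  -- for different `κ` meet only at their ends, so each pair collides for at most one `κ`, and some
  -- `κ` avoids all pairs.
  set σ : ℝ → ℝ → ℂ := fun κ s => s + κ * (s * (1 - s)) * Complex.I with hσ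
  set bad : ι × ι → Set ℝ := fun q => {κ | q.1 ≠ q.2 ∧
    ∃ s : ℝ, a q.1 + σ κ s * (b q.1 - a q.1) = a q.2 + σ κ s * (b q.2 - a q.2)} with hbad
  have hsub : ∀ q, (bad q).Subsingleton := by
    rintro ⟨i, j⟩ κ ⟨hij, s, hs⟩ κ' ⟨-, s', hs'⟩
    simp only at hs hs' hij
    have hA := sub_ne_zero.2 (ha i j hij)
    have hB := sub_ne_zero.2 (hb i j hij)
    set D := (b i - b j) - (a i - a j) with hD
    have h1 : (a i - a j) + σ κ s * D = 0 := by rw [hD]; linear_combination hs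
    have h2 : (a i - a j) + σ κ' s' * D = 0 := by rw [hD]; linear_combination hs'
    have hD0 : D ≠ 0 := fun h => hA (by simpa [h] using h1)
    have h3 : σ κ s = σ κ' s' := mul_right_cancel₀ hD0 (by linear_combination h1 - h2)
    have hre : s = s' := by simpa [hσ] using congrArg Complex.re h3
    have him : κ * (s * (1 - s)) = κ' * (s' * (1 - s')) := by
      simpa [hσ] using congrArg Complex.im h3
    subst hre
    refine mul_right_cancel₀ (mul_ne_zero ?_ ?_) him
    · rintro rfl
      exact hA (by simpa [hσ] using h1)
    · intro h
      have hs1 : s = 1 := by linarith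
      subst hs1
      exact hB (by simpa [hσ, hD] using h1)
  have hfin : (⋃ q, bad q).Finite := finite_iUnion fun q => (hsub q).finite
  obtain ⟨κ, hκ⟩ := hfin.infinite_compl.nonempty
  refine ⟨fun t i => a i + σ κ (t / T) * (b i - a i), fun i => ?_, ?_, ?_, fun t _ i j hij h => ?_⟩
  · have hofReal : ContDiff ℝ ∞ fun t : ℝ => ((t / T : ℝ) : ℂ) :=
      Complex.ofRealCLM.contDiff.comp (contDiff_id.div_const T)
    simp only [hσ]
    fun_prop
  · ext i; simp [hσ]
  · ext i; simp [hσ, hT.ne']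
  · exact hκ (mem_iUnion.2 ⟨(i, j), hij, t / T, h⟩)

theorem IsCompact.exists_pos_forall_le_norm {κ X F : Type*} [Finite κ] [TopologicalSpace X]
    [NormedAddCommGroup F] {s : Set X} (hs : IsCompact s) {f : κ → X → F}
    (hf : ∀ k, ContinuousOn (f k) s) (hne : ∀ k, ∀ t ∈ s, f k t ≠ 0) :
    ∃ δ > 0, ∀ k, ∀ t ∈ s, δ ≤ ‖f k t‖ := by
  -- Taking values in `Ioi 0` makes the common lower bound positive, even for empty `κ`.
  have h : ∀ k, ∃ δ : Ioi (0 : ℝ), ∀ t ∈ s, (δ : ℝ) ≤ ‖f k t‖ := fun k => by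
    obtain ⟨δ, h0, h1⟩ := hs.exists_forall_le' (hf k).norm
      fun t ht => norm_pos_iff.2 (hne k t ht)
    exact ⟨⟨δ, h0⟩, h1⟩
  choose δ hδ using h
  obtain ⟨m, hm⟩ := Finite.exists_ge δ
  exact ⟨m, m.2, fun k t ht => le_trans (hm k) (hδ k t ht)⟩

/-! ### The kernel in complex form -/

/-- The isometry `x + i y ↦ (x, y)` between `ℂ` and the plane. -/
noncomputable def complexEquivPlane : ℂ ≃ₗᵢ[ℝ] Plane := Complex.orthonormalBasisOneI.repr

/-- Rotation by a right angle is multiplication by `I`, and `z / |z| ^ 2` is the inverse of the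
conjugate of `z`. -/
theorem biotSavart_complexEquivPlane (z : ℂ) :
    biotSavart (complexEquivPlane z)
      = complexEquivPlane (Complex.I * (starRingEnd ℂ z)⁻¹) := by
  have hcoord : ∀ w : ℂ, complexEquivPlane w 0 = w.re ∧ complexEquivPlane w 1 = w.im := fun w => by
    simp [complexEquivPlane, Complex.orthonormalBasisOneI_repr_apply]
  rw [biotSavart, LinearIsometryEquiv.norm_map, Complex.sq_norm]
  ext k
  fin_cases k
  · simp [perp, hcoord, Complex.inv_im]
    ring
  · simp [perp, hcoord, Complex.inv_re]
    ring

/-- The identity `|1/z - 1/w| = |z - w| / (|z| |w|)` gives the bound directly, although the region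
`δ ≤ ‖u‖` is not convex. -/
theorem norm_biotSavart_sub_le {δ : ℝ} (hδ : 0 < δ) {u v : Plane} (hu : δ ≤ ‖u‖) (hv : δ ≤ ‖v‖) :
    ‖biotSavart u - biotSavart v‖ ≤ (δ ^ 2)⁻¹ * ‖u - v‖ := by
  obtain ⟨z, rfl⟩ := complexEquivPlane.surjective u
  obtain ⟨w, rfl⟩ := complexEquivPlane.surjective v
  rw [LinearIsometryEquiv.norm_map] at hu hv
  have hz : starRingEnd ℂ z ≠ 0 := by
    simpa using norm_pos_iff.1 (hδ.trans_le hu)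
  have hw : starRingEnd ℂ w ≠ 0 := by
    simpa using norm_pos_iff.1 (hδ.trans_le hv)
  rw [biotSavart_complexEquivPlane, biotSavart_complexEquivPlane, ← map_sub, ← map_sub,
    LinearIsometryEquiv.norm_map, LinearIsometryEquiv.norm_map, ← mul_sub, norm_mul,
    Complex.norm_I, one_mul, inv_sub_inv hz hw, norm_div, norm_mul, ← map_sub,
    Complex.norm_conj, Complex.norm_conj, Complex.norm_conj, norm_sub_rev, div_eq_inv_mul, sq]
  gcongr

/-! ### Uniqueness of solutions -/

variable {N : ℕ} {γ γc : Fin N → ℝ}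

theorem norm_vortexVelocity_sub_le {δ : ℝ} (hδ : 0 < δ) {w w' y : Fin N → Plane}
    (h1 : ∀ i j, i ≠ j → δ ≤ ‖w i - w j‖) (h2 : ∀ i j, δ ≤ ‖w i - y j‖)
    (h1' : ∀ i j, i ≠ j → δ ≤ ‖w' i - w' j‖) (h2' : ∀ i j, δ ≤ ‖w' i - y j‖) (i : Fin N) :
    ‖vortexVelocity γ γc w y i - vortexVelocity γ γc w' y i‖
      ≤ (∑ j, |γ j| * ((δ ^ 2)⁻¹ * 2) + ∑ j, |γc j| * (δ ^ 2)⁻¹) * ‖w - w'‖ := by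
  rw [vortexVelocity, vortexVelocity, add_sub_add_comm, ← Finset.sum_sub_distrib,
    ← Finset.sum_sub_distrib, add_mul, Finset.sum_mul, Finset.sum_mul]
  have hw : ∀ k, ‖w k - w' k‖ ≤ ‖w - w'‖ := fun k => norm_le_pi_norm (w - w') k
  refine (norm_add_le _ _).trans (add_le_add ?_ ?_)
  · refine (norm_sum_le_of_le (f := fun j => _) (n := fun j => |γ j| * ((δ ^ 2)⁻¹ * 2) * ‖w - w'‖)
      _ fun j hj => ?_).trans
      (Finset.sum_le_sum_of_subset_of_nonneg (Finset.erase_subset _ _) fun _ _ _ => by positivity)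
    have hij := (Finset.ne_of_mem_erase hj).symm
    rw [← smul_sub, norm_smul, Real.norm_eq_abs, mul_assoc, mul_assoc]
    refine mul_le_mul_of_nonneg_left ((norm_biotSavart_sub_le hδ (h1 i j hij) (h1' i j hij)).trans
      (mul_le_mul_of_nonneg_left ?_ (by positivity))) (abs_nonneg _)
    rw [sub_sub_sub_comm]
    linarith [norm_sub_le (w i - w' i) (w j - w' j), hw i, hw j]
  · refine norm_sum_le_of_le _ fun j _ => ?_
    rw [← smul_sub, norm_smul, Real.norm_eq_abs, mul_assoc]
    refine mul_le_mul_of_nonneg_left ((norm_biotSavart_sub_le hδ (h2 i j) (h2' i j)).trans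
      (mul_le_mul_of_nonneg_left ?_ (by positivity))) (abs_nonneg _)
    rw [sub_sub_sub_cancel_right]
    exact hw i

namespace IsVortexSolution

variable {T : ℝ} {x₀ : Fin N → Plane} {y x x' : ℝ → Fin N → Plane}

theorem mono (h : IsVortexSolution γ γc T x₀ y x) {τ : ℝ} (hτ : τ ≤ T) :
    IsVortexSolution γ γc τ x₀ y x :=
  have hs : Icc 0 τ ⊆ Icc 0 T := Icc_subset_Icc_right hτ
  ⟨h.initial, fun t ht => h.vortex_ne t (hs ht), fun t ht => h.control_ne t (hs ht),
    fun t ht i => (h.ode t (hs ht) i).mono hs⟩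

theorem continuousOn (h : IsVortexSolution γ γc T x₀ y x) : ContinuousOn x (Icc 0 T) :=
  continuousOn_pi.2 fun i t ht => (h.ode t ht i).continuousWithinAt

theorem hasDerivWithinAt_Ici (h : IsVortexSolution γ γc T x₀ y x) {t : ℝ} (ht : t ∈ Ico 0 T) :
    HasDerivWithinAt x (vortexVelocity γ γc (x t) (y t)) (Ici t) t :=
  hasDerivWithinAt_pi.2 fun i => (h.ode t (Ico_subset_Icc_self ht) i).mono_of_mem_nhdsWithin
    (mem_of_superset (Icc_mem_nhdsGE ht.2) (Icc_subset_Icc_left ht.1))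

theorem exists_separation (h : IsVortexSolution γ γc T x₀ y x) (hy : ContinuousOn y (Icc 0 T)) :
    ∃ δ > 0, ∀ t ∈ Icc 0 T, (∀ i j, i ≠ j → δ ≤ ‖x t i - x t j‖) ∧
      ∀ i j, δ ≤ ‖x t i - y t j‖ := by
  have hx := continuousOn_pi.1 h.continuousOn
  have hy' := continuousOn_pi.1 hy
  obtain ⟨δ₁, h₁, h₁'⟩ := isCompact_Icc.exists_pos_forall_le_norm (s := Icc 0 T)
    (κ := {q : Fin N × Fin N // q.1 ≠ q.2}) (f := fun q t => x t q.1.1 - x t q.1.2)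
    (fun q => (hx _).sub (hx _)) (fun q t ht => sub_ne_zero.2 (h.vortex_ne t ht _ _ q.2))
  obtain ⟨δ₂, h₂, h₂'⟩ := isCompact_Icc.exists_pos_forall_le_norm (s := Icc 0 T)
    (κ := Fin N × Fin N) (f := fun q t => x t q.1 - y t q.2)
    (fun q => (hx _).sub (hy' _)) (fun q t ht => sub_ne_zero.2 (h.control_ne t ht _ _))
  exact ⟨min δ₁ δ₂, lt_min h₁ h₂, fun t ht =>
    ⟨fun i j hij => (min_le_left _ _).trans (h₁' ⟨(i, j), hij⟩ t ht),
      fun i j => (min_le_right _ _).trans (h₂' (i, j) t ht)⟩⟩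

/-- By compactness both solutions stay in the configurations with some common separation `δ`, where
the velocity field is Lipschitz. -/
theorem eqOn (h : IsVortexSolution γ γc T x₀ y x) (h' : IsVortexSolution γ γc T x₀ y x')
    (hy : ContinuousOn y (Icc 0 T)) : EqOn x' x (Icc 0 T) := by
  obtain ⟨δ₁, h₁, hx⟩ := h.exists_separation hy
  obtain ⟨δ₂, h₂, hx'⟩ := h'.exists_separation hy
  have hδ := lt_min h₁ h₂
  set δ := min δ₁ δ₂
  have hL : 0 ≤ ∑ j, |γ j| * ((δ ^ 2)⁻¹ * 2) + ∑ j, |γc j| * (δ ^ 2)⁻¹ := by positivity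
  refine ODE_solution_unique_of_mem_Icc_right (K := ⟨_, hL⟩)
    (v := fun t w => vortexVelocity γ γc w (y t))
    (s := fun t => {w | (∀ i j, i ≠ j → δ ≤ ‖w i - w j‖) ∧ ∀ i j, δ ≤ ‖w i - y t j‖})
    (fun t _ => LipschitzOnWith.of_dist_le_mul fun w hw w' hw' => ?_)
    h'.continuousOn (fun t ht => h'.hasDerivWithinAt_Ici ht) (fun t ht => ?_)
    h.continuousOn (fun t ht => h.hasDerivWithinAt_Ici ht) (fun t ht => ?_)
    (h'.initial.trans h.initial.symm)
  · rw [dist_eq_norm, dist_eq_norm, pi_norm_le_iff_of_nonneg (by positivity)]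
    exact fun i => norm_vortexVelocity_sub_le hδ hw.1 hw.2 hw'.1 hw'.2 i
  · obtain ⟨ha, hb⟩ := hx' t (Ico_subset_Icc_self ht)
    exact ⟨fun i j hij => (min_le_right _ _).trans (ha i j hij),
      fun i j => (min_le_right _ _).trans (hb i j)⟩
  · obtain ⟨ha, hb⟩ := hx t (Ico_subset_Icc_self ht)
    exact ⟨fun i j hij => (min_le_left _ _).trans (ha i j hij),
      fun i j => (min_le_left _ _).trans (hb i j)⟩

end IsVortexSolution

/-! ### Construction of the controls -/

theorem vortexVelocity_complexEquivPlane {N : ℕ} (γ γc : Fin N → ℝ) (z ζ : Fin N → ℂ)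
    (i : Fin N) :
    vortexVelocity γ γc (fun j => complexEquivPlane (z j)) (fun j => complexEquivPlane (ζ j)) i
      = complexEquivPlane (Complex.I * starRingEnd ℂ
        (∑ j ∈ Finset.univ.erase i, (γ j : ℂ) / (z i - z j)
          + ∑ j, (γc j : ℂ) / (z i - ζ j))) := by
  simp only [vortexVelocity, ← map_sub, biotSavart_complexEquivPlane, ← map_smul, ← map_sum,
    ← map_add]
  simp only [map_add, map_sum, map_div₀, Complex.conj_ofReal, mul_add, Finset.mul_sum,
    Complex.real_smul]
  congr 2 <;> exact funext fun j => congrArg _ (by ring)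

theorem theorem2 (N : ℕ) (γ γc : Fin N → ℝ) (hγ : ∀ i, γ i ≠ 0) (hγc : ∀ i, γc i ≠ 0)
    (x₀ xf : Fin N → Plane)
    (hx₀ : ∀ i j, i ≠ j → x₀ i ≠ x₀ j) (hxf : ∀ i j, i ≠ j → xf i ≠ xf j)
    (T : ℝ) (hT : 0 < T) :
    ∃ y : ℝ → Fin N → Plane,
      (∀ j, ContDiffOn ℝ ∞ (fun t => y t j) (Set.Icc 0 T)) ∧
      ∃ x : ℝ → Fin N → Plane,
        IsVortexSolution γ γc T x₀ y x ∧
        (∀ τ ∈ Set.Icc 0 T, ∀ x' : ℝ → Fin N → Plane,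
          IsVortexSolution γ γc τ x₀ y x' → Set.EqOn x' x (Set.Icc 0 τ)) ∧
        x T = xf ∧
        ∀ t ∈ Set.Icc 0 T,
          (∀ i j, x t i ≠ y t j) ∧
          (∀ i j, i ≠ j → x t i ≠ x t j) ∧
          (∀ i j, i ≠ j → y t i ≠ y t j) := by
  set e := complexEquivPlane with he
  obtain ⟨p, hp, hp0, hpT, hpne⟩ := exists_contDiff_path_pairwise_ne
    (a := fun i => e.symm (x₀ i)) (b := fun i => e.symm (xf i))
    (fun i j hij => e.symm.injective.ne (hx₀ i j hij))
    (fun i j hij => e.symm.injective.ne (hxf i j hij)) hT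
  obtain ⟨δ, hδ, hsep⟩ := isCompact_Icc.exists_pos_forall_le_norm (s := Icc 0 T)
    (κ := {q : Fin N × Fin N // q.1 ≠ q.2}) (f := fun q t => p t q.1.1 - p t q.1.2)
    (fun q => ((hp _).continuous.sub (hp _).continuous).continuousOn)
    (fun q t ht => sub_ne_zero.2 (hpne t ht _ _ q.2))
  set p' : ℝ → Fin N → ℂ := fun t i => deriv (fun t => p t i) t with hp'
  have hp's : ∀ i, ContDiff ℝ ∞ fun t => p' t i := fun i => (contDiff_infty_iff_deriv.1 (hp i)).2
  have hpd : ∀ i t, HasDerivAt (fun t => p t i) (p' t i) t := fun i t =>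
    ((hp i).differentiable (by simp) t).hasDerivAt
  obtain ⟨M, hM⟩ := isCompact_Icc.exists_bound_of_continuousOn (s := Icc 0 T) (f := p')
    (continuous_pi fun i => (hp's i).continuous).continuousOn
  set C := ∑ j, |γc j| with hC
  have hC0 : 0 ≤ C := by positivity
  -- Chosen so that `C * r ≤ δ / 4`; the `+ 1` covers `C = 0`, which occurs for `N = 0`.
  set r := δ / (4 * (C + 1)) with hr
  have hr0 : 0 < r := by positivity
  have hCr : C * r ≤ δ / 4 := by
    rw [hr, mul_div_assoc', div_le_div_iff₀ (by positivity) (by positivity)]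
    nlinarith
  -- All vortices additionally follow a common circle at high speed, which forces the controls to
  -- stay near their vortices.
  set A : ℝ := M + ∑ j, |γ j| / δ + 3 / r with hA
  set ν : ℂ := 2 * Real.pi * Complex.I / T with hν
  have hTC : (T : ℂ) ≠ 0 := by exact_mod_cast hT.ne'
  have hν0 : ν ≠ 0 := by
    rw [hν]; exact div_ne_zero Complex.two_pi_I_ne_zero hTC
  -- The primitive of `c'` vanishing at `0`; the choice of `ν` gives it period `T`, so it also
  -- vanishes at `T`.
  set c : ℝ → ℂ := fun t => A / ν * (Complex.exp (ν * t) - 1) with hc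
  set c' : ℝ → ℂ := fun t => A * Complex.exp (ν * t) with hc'
  have hcd : ∀ t, HasDerivAt c (c' t) t := fun t => by
    have h1 : HasDerivAt (fun t : ℝ => ν * (t : ℂ)) ν t := by
      simpa using (Complex.ofRealCLM.hasDerivAt (x := t)).const_mul ν
    convert! (h1.cexp.sub_const 1).const_mul (A / ν) using 1
    simp only [hc']
    field_simp
  have hcs : ContDiff ℝ ∞ c := by
    have : ContDiff ℝ ∞ fun t : ℝ => (t : ℂ) := Complex.ofRealCLM.contDiff
    fun_prop
  have hcs' : ContDiff ℝ ∞ c' := by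
    have : ContDiff ℝ ∞ fun t : ℝ => (t : ℂ) := Complex.ofRealCLM.contDiff
    fun_prop
  have hcn : ∀ t, A ≤ ‖c' t‖ := fun t => by
    have h1 : ν * t = ((2 * Real.pi * t / T : ℝ) : ℂ) * Complex.I := by
      rw [hν]; push_cast; ring
    simp only [hc', norm_mul, h1, Complex.norm_exp_ofReal_mul_I, Complex.norm_real, mul_one]
    exact le_abs_self A
  have hc0 : c 0 = 0 := by simp [hc]
  have hcT : c T = 0 := by
    have : ν * T = 2 * Real.pi * Complex.I := by rw [hν]; field_simp
    simp [hc, this, Complex.exp_two_pi_mul_I]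
  set z : ℝ → Fin N → ℂ := fun t i => p t i + c t with hz
  have hzs : ∀ i, ContDiff ℝ ∞ fun t => z t i := fun i => (hp i).add hcs
  have hzsub : ∀ t i j, z t i - z t j = p t i - p t j := fun t i j => by simp [hz]
  have hzsep : ∀ t ∈ Icc 0 T, ∀ i j, i ≠ j → δ ≤ ‖z t i - z t j‖ := fun t ht i j hij => by
    rw [hzsub]; exact hsep ⟨(i, j), hij⟩ t ht
  have hzne : ∀ t ∈ Icc 0 T, ∀ i j, i ≠ j → z t i - z t j ≠ 0 := fun t ht i j hij =>
    norm_pos_iff.1 (hδ.trans_le (hzsep t ht i j hij))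
  -- The map `v ↦ I * conj v` is an involution, so this inverts the velocity formula in
  -- `vortexVelocity_complexEquivPlane`.
  set W : ℝ → Fin N → ℂ := fun t i => Complex.I * starRingEnd ℂ (p' t i + c' t)
    - ∑ j ∈ Finset.univ.erase i, (γ j : ℂ) / (z t i - z t j) with hW
  obtain ⟨ζ, hζ, hζs⟩ := exists_contDiffOn_sum_div_eq hγc (s := Icc 0 T) (z := z) (W := W) hδ hr0
    hCr (fun i t _ => (hzs i).contDiffAt)
    (by
      intro i t ht
      refine ContDiffAt.sub (contDiffAt_const.mul ?_) (ContDiffAt.sum fun j hj => ?_)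
      · exact (Complex.conjCLE.contDiff.comp ((hp's i).add hcs')).contDiffAt
      · simp only [div_eq_mul_inv]
        exact contDiffAt_const.mul (((hzs i).sub (hzs j)).contDiffAt.inv
          (hzne t ht i j (Finset.ne_of_mem_erase hj).symm)))
    hzsep
    (by
      intro t ht i
      -- Of the three terms of `A`, `M` absorbs `p'`, the sum absorbs the mutual interaction, and `3
      -- / r` remains.
      have h1 : ‖∑ j ∈ Finset.univ.erase i, (γ j : ℂ) / (z t i - z t j)‖ ≤ ∑ j, |γ j| / δ := by
        refine (norm_sum_le_of_le (n := fun j => |γ j| / δ) _ fun j hj => ?_).trans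
          (Finset.sum_le_sum_of_subset_of_nonneg (Finset.erase_subset _ _)
            fun _ _ _ => by positivity)
        rw [norm_div, Complex.norm_real, Real.norm_eq_abs]
        exact div_le_div_of_nonneg_left (abs_nonneg _) hδ
          (hzsep t ht i j (Finset.ne_of_mem_erase hj).symm)
      have h2 : ‖p' t i‖ ≤ M := (norm_le_pi_norm (p' t) i).trans (hM t ht)
      have h3 : A - M ≤ ‖Complex.I * starRingEnd ℂ (p' t i + c' t)‖ := by
        rw [norm_mul, Complex.norm_I, one_mul, Complex.norm_conj]
        have := norm_sub_norm_le (c' t) (-p' t i)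
        rw [norm_neg, sub_neg_eq_add, add_comm] at this
        linarith [hcn t]
      have h4 := norm_sub_norm_le (Complex.I * starRingEnd ℂ (p' t i + c' t))
        (∑ j ∈ Finset.univ.erase i, (γ j : ℂ) / (z t i - z t j))
      simp only [hW]
      linarith)
  have hys : ∀ j, ContDiffOn ℝ ∞ (fun t => e (ζ t j)) (Icc 0 T) := fun j =>
    e.contDiff.comp_contDiffOn (hζ j)
  have hsol : IsVortexSolution γ γc T x₀ (fun t j => e (ζ t j)) (fun t i => e (z t i)) := by
    refine ⟨?_, fun t ht i j hij => e.injective.ne (sub_ne_zero.1 (hzne t ht i j hij)),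
      fun t ht i j => e.injective.ne ((hζs t ht).1 i j), fun t ht i => ?_⟩
    · ext1 i
      simp [hz, hp0, hc0]
    · have h1 : vortexVelocity γ γc (fun j => e (z t j)) (fun j => e (ζ t j)) i
          = e (p' t i + c' t) := by
        rw [he, vortexVelocity_complexEquivPlane, (hζs t ht).2.2 i]
        simp only [hW, add_sub_cancel, map_mul, Complex.conj_I, Complex.conj_conj]
        rw [← mul_assoc, mul_neg, Complex.I_mul_I, neg_neg, one_mul]
      rw [h1]
      exact ((e.toContinuousLinearEquiv : ℂ →L[ℝ] Plane).hasFDerivAt.comp_hasDerivAt t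
        ((hpd i t).add (hcd t))).hasDerivWithinAt
  refine ⟨_, hys, _, hsol, fun τ hτ x' hx' => ?_, ?_, fun t ht => ⟨hsol.control_ne t ht,
    hsol.vortex_ne t ht, fun i j hij => e.injective.ne ((hζs t ht).2.1 i j hij)⟩⟩
  · exact (hsol.mono hτ.2).eqOn hx' (continuousOn_pi.2 fun j =>
      (hys j).continuousOn.mono (Icc_subset_Icc_right hτ.2))
  · ext1 i
    simp [hz, hpT, hcT]
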